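/- Let $V$ be an $\ell$-dimensional complex inner product space and let $W\subset GL(V)$ be a finite group generated by unitary reflections (unitary maps whose fixed space is a hyperplane). Let $\mathcal A$ be the set of the reflecting hyperplanes of the reflections in $W$; for each $H\in\mathcal A$ choose a linear form $\alpha_H\in V^*$ with kernel $H$, and put $Q=\prod_{H\in\mathcal A}\alpha_H$. Let $S$ be the algebra of polynomial functions on $V$, let $\Omega^p=S\otimes_{\mathbb C}\bigwedge^pV^*$ be the $S$-module of polynomial differential $p$-forms, with $W$ acting contragrediently on $V^*$, $S$ and $\Omega^p$, and let $d$ be the exterior derivative of rational differential forms. Put $R=S^W$, $$(\Omega^p)^{\det^{-1}}=\{\eta\in\Omega^p \mid w\eta=\det(w)^{-1}\eta\ \text{for all } w\in W\},$$ an $R$-module, where $\det(w)$ is the determinant of $w$ on $V$, and let $$\Omega^p(\mathcal A)=\left\{\tfrac{\eta}{Q} \;\middle|\; \eta\in\Omega^p,\ d\!\left(\tfrac{\eta}{Q}\right)\in\tfrac1Q\,\Omega^{p+1}\right\}$$ be the module of logarithmic $p$-forms with poles along $\mathcal A$. Then for every $0\le p\le\ell$, $$\Omega^p(\mathcal A)=\frac1Q(\Omega^p)^{\det^{-1}}\otimes_RS,$$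 that is, the multiplication map from $\frac1Q(\Omega^p)^{\det^{-1}}\otimes_RS$ to the rational $p$-forms is injective and its image is $\Omega^p(\mathcal A)$. In particular, $\Omega^p(\mathcal A)$ is the $S$-span of $\frac1Q(\Omega^p)^{\det^{-1}}$. -/

import Mathlib

open scoped TensorProduct nonZeroDivisors

noncomputable section

namespace UnitaryReflection

/-! ### Derivations of a domain, extended to its field of fractions by the quotient rule -/

section FracDeriv

theorem exists_fraction {S : Type*} [CommRing S] [IsDomain S] (x : FractionRing S) : ∃ a b : S, b ≠ 0 ∧
    x * algebraMap S (FractionRing S) b = algebraMap S (FractionRing S) a :=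
  ⟨_, _, nonZeroDivisors.ne_zero (IsLocalization.sec S⁰ x).2.2, IsLocalization.sec_spec S⁰ x⟩

variable {S : Type*} [CommRing S] [IsDomain S] [Algebra ℂ S]

/-- The quotient rule, applied to a chosen representation `x = a / b`. -/
def quotientRule (δ : Derivation ℂ S S) (x : FractionRing S) : FractionRing S :=
  let a : S := (IsLocalization.sec S⁰ x).1
  let b : S := ((IsLocalization.sec S⁰ x).2 : S)
  algebraMap S (FractionRing S) (b * δ a - a * δ b) / (algebraMap S (FractionRing S) b) ^ 2

/-- The quotient rule does not depend on the representation as a fraction. -/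
theorem quotientRule_eq (δ : Derivation ℂ S S) (x : FractionRing S) (a b : S) (hb : b ≠ 0)
    (hx : x * algebraMap S (FractionRing S) b = algebraMap S (FractionRing S) a) :
    quotientRule δ x = algebraMap S (FractionRing S) (b * δ a - a * δ b) /
      (algebraMap S (FractionRing S) b) ^ 2 := by
  have hinj := IsFractionRing.injective S (FractionRing S)
  have hsec := IsLocalization.sec_spec S⁰ x
  unfold quotientRule
  set c : S := (IsLocalization.sec S⁰ x).1
  have hd : ((IsLocalization.sec S⁰ x).2 : S) ≠ 0 :=
    nonZeroDivisors.ne_zero (IsLocalization.sec S⁰ x).2.2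
  set d : S := ((IsLocalization.sec S⁰ x).2 : S)
  have hcross : c * b = a * d := by
    apply hinj
    rw [map_mul, map_mul, ← hx, ← hsec]
    ring
  have hb' : algebraMap S (FractionRing S) b ≠ 0 := by
    rwa [Ne, map_eq_zero_iff _ hinj]
  have hd' : algebraMap S (FractionRing S) d ≠ 0 := by
    rwa [Ne, map_eq_zero_iff _ hinj]
  have hder := congrArg δ hcross
  simp only [Derivation.leibniz, smul_eq_mul] at hder
  change algebraMap S (FractionRing S) (d * δ c - c * δ d) / _ = _
  rw [div_eq_div_iff (pow_ne_zero 2 hd') (pow_ne_zero 2 hb'), ← map_pow, ← map_pow,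
    ← map_mul, ← map_mul]
  congr 1
  linear_combination (b * d) * hder - (b * δ d + d * δ b) * hcross

theorem quotientRule_algebraMap (δ : Derivation ℂ S S) (f : S) :
    quotientRule δ (algebraMap S (FractionRing S) f) = algebraMap S (FractionRing S) (δ f) := by
  rw [quotientRule_eq δ _ f 1 one_ne_zero (by simp)]
  simp

theorem quotientRule_add (δ : Derivation ℂ S S) (x y : FractionRing S) :
    quotientRule δ (x + y) = quotientRule δ x + quotientRule δ y := by
  have hinj := IsFractionRing.injective S (FractionRing S)
  obtain ⟨a, b, hb, hx⟩ := exists_fraction x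
  obtain ⟨c, d, hd, hy⟩ := exists_fraction y
  have hb' : algebraMap S (FractionRing S) b ≠ 0 := by
    rwa [Ne, map_eq_zero_iff _ hinj]
  have hd' : algebraMap S (FractionRing S) d ≠ 0 := by
    rwa [Ne, map_eq_zero_iff _ hinj]
  rw [quotientRule_eq δ x a b hb hx, quotientRule_eq δ y c d hd hy,
    quotientRule_eq δ (x + y) (a * d + c * b) (b * d) (mul_ne_zero hb hd)
      (by simp only [map_add, map_mul, ← hx, ← hy]; ring)]
  simp only [Derivation.leibniz, smul_eq_mul, map_add, map_sub, map_mul]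
  field_simp
  ring

theorem quotientRule_mul (δ : Derivation ℂ S S) (x y : FractionRing S) :
    quotientRule δ (x * y) = x * quotientRule δ y + y * quotientRule δ x := by
  have hinj := IsFractionRing.injective S (FractionRing S)
  obtain ⟨a, b, hb, hx⟩ := exists_fraction x
  obtain ⟨c, d, hd, hy⟩ := exists_fraction y
  have hb' : algebraMap S (FractionRing S) b ≠ 0 := by
    rwa [Ne, map_eq_zero_iff _ hinj]
  have hd' : algebraMap S (FractionRing S) d ≠ 0 := by
    rwa [Ne, map_eq_zero_iff _ hinj]
  rw [quotientRule_eq δ x a b hb hx, quotientRule_eq δ y c d hd hy,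
    quotientRule_eq δ (x * y) (a * c) (b * d) (mul_ne_zero hb hd)
      (by simp only [map_mul, ← hx, ← hy]; ring)]
  rw [eq_div_of_mul_eq hb' hx, eq_div_of_mul_eq hd' hy]
  simp only [Derivation.leibniz, smul_eq_mul, map_add, map_sub, map_mul]
  field_simp
  ring

/-- The unique extension of a derivation of `S` to its field of fractions. -/
def fracDeriv (δ : Derivation ℂ S S) : Derivation ℂ (FractionRing S) (FractionRing S) :=
  Derivation.mk'
    { toFun := quotientRule δ
      map_add' := quotientRule_add δ
      map_smul' := fun c x => by
        rw [Algebra.smul_def, quotientRule_mul, IsScalarTower.algebraMap_apply ℂ S (FractionRing S),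
          quotientRule_algebraMap, Derivation.map_algebraMap, map_zero, mul_zero, add_zero,
          RingHom.id_apply, Algebra.smul_def, IsScalarTower.algebraMap_apply ℂ S (FractionRing S)] }
    (fun x y => quotientRule_mul δ x y)

theorem fracDeriv_add (δ ε : Derivation ℂ S S) : fracDeriv (δ + ε) = fracDeriv δ + fracDeriv ε := by
  ext x
  change quotientRule (δ + ε) x = quotientRule δ x + quotientRule ε x
  simp only [quotientRule, map_add, map_sub, map_mul, Derivation.coe_add, Pi.add_apply]
  ring

theorem fracDeriv_smul (c : ℂ) (δ : Derivation ℂ S S) : fracDeriv (c • δ) = c • fracDeriv δ := by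
  ext x
  change quotientRule (c • δ) x = c • quotientRule δ x
  simp only [quotientRule, Derivation.coe_smul, Pi.smul_apply, map_sub, map_mul, Algebra.smul_def,
    IsScalarTower.algebraMap_apply ℂ S (FractionRing S)]
  ring

end FracDeriv

/-! ### Polynomial functions, rational functions and directional derivatives

`V` is a complex vector space with a basis `b = (e_1, …, e_ℓ)`; the variable `X i` is the `i`-th
dual basis vector `x_i`, so that `MvPolynomial (Fin ℓ) ℂ` is the algebra `S` of polynomial
functions on `V`. -/

/-- The algebra `S` of polynomial functions. -/
abbrev Poly (l : ℕ) : Type := MvPolynomial (Fin l) ℂ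

/-- The field of rational functions, the field of fractions of `S`. -/
abbrev RatFun (l : ℕ) : Type := FractionRing (Poly l)

section Coordinates

variable {V : Type*} [AddCommGroup V] [Module ℂ V] {l : ℕ}

/-- A linear form on `V`, as a polynomial function of degree one. -/
def linForm (b : Module.Basis (Fin l) ℂ V) (x : Module.Dual ℂ V) : Poly l :=
  ∑ i, MvPolynomial.C (x (b i)) * MvPolynomial.X i

/-- The derivation `∂_v` of `S`, with `∂_v x = ⟨x, v⟩` for linear forms `x`. -/
def dirDeriv (b : Module.Basis (Fin l) ℂ V) (v : V) : Derivation ℂ (Poly l) (Poly l) :=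
  MvPolynomial.mkDerivation ℂ fun i => MvPolynomial.C (b.repr v i)

/-- The derivation `∂_v` of the field of rational functions. -/
def ratDeriv (b : Module.Basis (Fin l) ℂ V) (v : V) : Derivation ℂ (RatFun l) (RatFun l) :=
  fracDeriv (dirDeriv b v)

theorem dirDeriv_add (b : Module.Basis (Fin l) ℂ V) (v w : V) :
    dirDeriv b (v + w) = dirDeriv b v + dirDeriv b w := by
  apply MvPolynomial.derivation_ext
  intro i
  simp [dirDeriv, MvPolynomial.mkDerivation_X]

theorem dirDeriv_smul (b : Module.Basis (Fin l) ℂ V) (c : ℂ) (v : V) :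
    dirDeriv b (c • v) = c • dirDeriv b v := by
  apply MvPolynomial.derivation_ext
  intro i
  simp [dirDeriv, MvPolynomial.mkDerivation_X, MvPolynomial.smul_eq_C_mul]

/-- The contragredient action of `w ∈ GL(V)` on `S`: `(w f)(v) = f (w⁻¹ v)`. -/
def polyAct (b : Module.Basis (Fin l) ℂ V) (w : V ≃ₗ[ℂ] V) : Poly l →ₐ[ℂ] Poly l :=
  MvPolynomial.aeval fun i => linForm b (b.coord i ∘ₗ (w⁻¹ : V ≃ₗ[ℂ] V).toLinearMap)

/-! ### Differential forms -/

/-- Polynomial differential `p`-forms `Ω^p = S ⊗ ⋀^p V^*`, as alternating forms on `V` with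
values in `S`: the form `f dx_{i_1} ∧ ⋯ ∧ dx_{i_p}` takes `(v_1, …, v_p)` to
`f * det (x_{i_j} (v_k))`. -/
abbrev PolyForm (V : Type*) [AddCommGroup V] [Module ℂ V] (l p : ℕ) : Type _ :=
  V [⋀^Fin p]→ₗ[ℂ] Poly l

/-- Rational differential `p`-forms. -/
abbrev RatForm (V : Type*) [AddCommGroup V] [Module ℂ V] (l p : ℕ) : Type _ :=
  V [⋀^Fin p]→ₗ[ℂ] RatFun l

/-- A polynomial form, regarded as a rational form. -/
def toRatForm {p : ℕ} (η : PolyForm V l p) : RatForm V l p :=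
  (IsScalarTower.toAlgHom ℂ (Poly l) (RatFun l)).toLinearMap.compAlternatingMap η

/-- The exterior derivative of rational forms,
`(dω)(v_0, …, v_p) = ∑ i, (-1)^i ∂_{v_i} (ω (v_0, …, v_{i-1}, v_{i+1}, …, v_p))`. -/
def extDer (b : Module.Basis (Fin l) ℂ V) {p : ℕ} (ω : RatForm V l p) : RatForm V l (p + 1) :=
  AlternatingMap.alternatizeUncurryFin
    { toFun := fun v => ((ratDeriv b v : RatFun l →ₗ[ℂ] RatFun l)).compAlternatingMap ω
      map_add' := fun v w => by
        ext u
        simp [ratDeriv, dirDeriv_add, fracDeriv_add]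
      map_smul' := fun c v => by
        ext u
        simp [ratDeriv, dirDeriv_smul, fracDeriv_smul] }

/-- The action of `w ∈ GL(V)` on `Ω^p`, induced by the contragredient actions on `S` and
on `V^*`. -/
def formAct (b : Module.Basis (Fin l) ℂ V) {p : ℕ} (w : V ≃ₗ[ℂ] V) (η : PolyForm V l p) :
    PolyForm V l p :=
  (polyAct b w).toLinearMap.compAlternatingMap
    (η.compLinearMap (w⁻¹ : V ≃ₗ[ℂ] V).toLinearMap)

/-! ### Invariants and anti-invariant forms -/

/-- The invariant subring `R = S^W`. -/
def invariants (b : Module.Basis (Fin l) ℂ V) (W : Subgroup (V ≃ₗ[ℂ] V)) :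
    Subalgebra ℂ (Poly l) where
  carrier := {f | ∀ w ∈ W, polyAct b w f = f}
  mul_mem' := fun hf hg w hw => by rw [map_mul, hf w hw, hg w hw]
  add_mem' := fun hf hg w hw => by rw [map_add, hf w hw, hg w hw]
  algebraMap_mem' := fun c w _ => AlgHom.commutes _ c

/-- The `R`-module `(Ω^p)^{det⁻¹}` of anti-invariant `p`-forms. -/
def antiInvariants (b : Module.Basis (Fin l) ℂ V) (W : Subgroup (V ≃ₗ[ℂ] V)) (p : ℕ) :
    Submodule (invariants b W) (PolyForm V l p) where
  carrier := {η | ∀ w ∈ W, formAct b w η = (LinearMap.det (w : V →ₗ[ℂ] V))⁻¹ • η}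
  add_mem' := fun {η ζ} hη hζ w hw => by
    rw [smul_add, ← hη w hw, ← hζ w hw]
    ext u
    simp [formAct]
  zero_mem' := fun w _ => by
    rw [smul_zero]
    ext u
    simp [formAct]
  smul_mem' := fun r η hη w hw => by
    rw [smul_comm, ← hη w hw]
    ext u : 1
    change polyAct b w ((r : Poly l) * _) = (r : Poly l) * polyAct b w _
    rw [map_mul, r.2 w hw]
    rfl

/-- Division of polynomial forms by `Q`, `η ↦ η / Q`, as an `S`-linear map. -/
def divForm (Q : Poly l) (p : ℕ) : PolyForm V l p →ₗ[Poly l] RatForm V l p where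
  toFun := fun η => (algebraMap (Poly l) (RatFun l) Q)⁻¹ • toRatForm η
  map_add' := fun η ζ => by
    ext u
    simp [toRatForm]
  map_smul' := fun f η => by
    ext u
    simp only [toRatForm, AlternatingMap.smul_apply, LinearMap.compAlternatingMap_apply,
      AlgHom.toLinearMap_apply, smul_eq_mul, map_mul, IsScalarTower.coe_toAlgHom',
      Algebra.smul_def, RingHom.id_apply]
    exact mul_left_comm _ _ _

/-- The `R`-submodule `(1/Q) (Ω^p)^{det⁻¹}` of the rational `p`-forms. -/
def antiInvariantsDiv (b : Module.Basis (Fin l) ℂ V) (W : Subgroup (V ≃ₗ[ℂ] V)) (Q : Poly l)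
    (p : ℕ) : Submodule (invariants b W) (RatForm V l p) :=
  (antiInvariants b W p).map ((divForm Q p).restrictScalars (invariants b W))

instance antiInvariantsDivModule (b : Module.Basis (Fin l) ℂ V) (W : Subgroup (V ≃ₗ[ℂ] V))
    (Q : Poly l) (p : ℕ) : Module (invariants b W) (antiInvariantsDiv b W Q p) :=
  Submodule.module (antiInvariantsDiv b W Q p)

/-- The `S`-linear multiplication map `S ⊗_R (1/Q) (Ω^p)^{det⁻¹} → {rational p-forms}`. -/
def mulMap (b : Module.Basis (Fin l) ℂ V) (W : Subgroup (V ≃ₗ[ℂ] V)) (Q : Poly l) (p : ℕ) :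
    Poly l ⊗[invariants b W] (antiInvariantsDiv b W Q p) →ₗ[Poly l] RatForm V l p :=
  LinearMap.liftBaseChange (Poly l) (antiInvariantsDiv b W Q p).subtype

/-! ### Logarithmic forms -/

/-- Logarithmic `p`-forms: the forms `η / Q` with `η ∈ Ω^p` and `d (η / Q) ∈ (1/Q) Ω^{p+1}`. -/
def logForms (b : Module.Basis (Fin l) ℂ V) (Q : Poly l) (p : ℕ) : Set (RatForm V l p) :=
  {ω | (∃ η : PolyForm V l p, ω = divForm Q p η) ∧
    ∃ ζ : PolyForm V l (p + 1), extDer b ω = divForm Q (p + 1) ζ}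

end Coordinates

/-! ### Unitary reflection groups and their arrangements -/

section Reflections

variable {V : Type*} [NormedAddCommGroup V] [InnerProductSpace ℂ V]

/-- The space of vectors fixed by `s`. -/
def fixedSpace (s : V ≃ₗ[ℂ] V) : Submodule ℂ V :=
  LinearMap.ker ((s : V →ₗ[ℂ] V) - LinearMap.id)

/-- A unitary reflection: a unitary transformation whose fixed space is a hyperplane. -/
def IsUnitaryReflection (s : V ≃ₗ[ℂ] V) : Prop :=
  (∀ u v : V, inner ℂ (s u) (s v) = inner ℂ u v) ∧
    Module.finrank ℂ (fixedSpace s) + 1 = Module.finrank ℂ V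

/-- A unitary reflection group: a finite group generated by unitary reflections. -/
def IsUnitaryReflectionGroup (W : Subgroup (V ≃ₗ[ℂ] V)) : Prop :=
  Finite W ∧ Subgroup.closure {s : V ≃ₗ[ℂ] V | s ∈ W ∧ IsUnitaryReflection s} = W

/-- The set of the reflecting hyperplanes of the reflections in `W`. -/
def arrangement (W : Subgroup (V ≃ₗ[ℂ] V)) : Set (Submodule ℂ V) :=
  {H | ∃ s ∈ W, IsUnitaryReflection s ∧ fixedSpace s = H}

/-- The polynomial `Q = ∏ α_H`, the product over the (finitely many) reflecting hyperplanes. -/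
def definingPoly {l : ℕ} (b : Module.Basis (Fin l) ℂ V) (W : Subgroup (V ≃ₗ[ℂ] V))
    (α : arrangement W → Module.Dual ℂ V) : Poly l :=
  ∏ᶠ H : arrangement W, linForm b (α H)

end Reflections

end UnitaryReflection

end

noncomputable section

namespace UnitaryReflection

/-! ### Linear forms and the action on polynomial functions -/

section Coordinates

variable {V : Type*} [AddCommGroup V] [Module ℂ V] {l : ℕ}

/-! Being logarithmic is a condition on one hyperplane at a time. Since d(η/Q) = dη/Q - (dQ ∧ η)/Q²,
the form η/Q is logarithmic iff Q divides dQ ∧ η. Modulo α_H only the term (∏_{K ≠ H} α_K) dα_H of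
dQ survives, so the condition says that, for each H, α_H divides η on tuples of vectors of H
(`logNumerators`, `divForm_mem_logForms_iff`).

Twist the action on Ω^p by det, so that the anti-invariant forms become the fixed forms. A fixed
form satisfies the condition because det s ≠ 1 for a reflection s. Conversely, if η satisfies it and
s is a reflection along H, then sη - η = α_H θ, where θ satisfies it too and has smaller degree
(`exists_twistAct_sub_eq_smul`). By induction on the degree, θ lies in the S-span N of the fixed
forms, so sη ≡ η mod N. Reflections generate W and N is W-stable, hence wη ≡ η mod N for all w, and
averaging over W puts η in N (`logNumerators_le_span`).

Injectivity is the same descent on the tensor product. The divided difference δ = (s - 1)/α_H is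
R-linear on S, so δ ⊗ 1 is defined; it preserves the kernel of multiplication and lowers the degree.
By induction it kills a given kernel element t, so t is W-fixed; averaging gives |W| t = 1 ⊗ m, and
m is its image, which is 0 (`eq_zero_of_polyMulMap_eq_zero`). Freeness of S over R is never needed.
-/

theorem linForm_add (b : Module.Basis (Fin l) ℂ V) (x y : Module.Dual ℂ V) :
    linForm b (x + y) = linForm b x + linForm b y := by
  simp [linForm, add_mul, Finset.sum_add_distrib]

theorem linForm_smul (b : Module.Basis (Fin l) ℂ V) (c : ℂ) (x : Module.Dual ℂ V) :
    linForm b (c • x) = MvPolynomial.C c * linForm b x := by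
  simp [linForm, Finset.mul_sum, mul_assoc]

theorem linForm_sub (b : Module.Basis (Fin l) ℂ V) (x y : Module.Dual ℂ V) :
    linForm b (x - y) = linForm b x - linForm b y := by
  simp [linForm, sub_mul, Finset.sum_sub_distrib]

theorem linForm_coord (b : Module.Basis (Fin l) ℂ V) (i : Fin l) :
    linForm b (b.coord i) = MvPolynomial.X i := by
  rw [linForm, Finset.sum_eq_single i]
  · simp
  · intro j _ hj
    simp [hj.symm]
  · simp

theorem coeff_linForm (b : Module.Basis (Fin l) ℂ V) (x : Module.Dual ℂ V) (i : Fin l) :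
    (linForm b x).coeff (Finsupp.single i 1) = x (b i) := by
  classical
  rw [linForm, MvPolynomial.coeff_sum, Finset.sum_eq_single i]
  · simp [MvPolynomial.coeff_C_mul, MvPolynomial.coeff_X]
  · intro j _ hj
    simp [MvPolynomial.coeff_C_mul, MvPolynomial.coeff_X, Finsupp.single_left_inj, hj]
  · simp

theorem linForm_injective (b : Module.Basis (Fin l) ℂ V) : Function.Injective (linForm b) := by
  intro x y h
  refine b.ext fun i => ?_
  rw [← coeff_linForm, h, coeff_linForm]

theorem linForm_ne_zero (b : Module.Basis (Fin l) ℂ V) {x : Module.Dual ℂ V} (hx : x ≠ 0) :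
    linForm b x ≠ 0 := fun h => hx <| linForm_injective b <| h.trans (by simp [linForm])

theorem isHomogeneous_linForm (b : Module.Basis (Fin l) ℂ V) (x : Module.Dual ℂ V) :
    (linForm b x).IsHomogeneous 1 := by
  refine MvPolynomial.IsHomogeneous.sum _ _ _ fun i _ => ?_
  simpa using (MvPolynomial.isHomogeneous_C _ (x (b i))).mul (MvPolynomial.isHomogeneous_X ℂ i)

theorem totalDegree_linForm (b : Module.Basis (Fin l) ℂ V) {x : Module.Dual ℂ V} (hx : x ≠ 0) :
    (linForm b x).totalDegree = 1 :=
  (isHomogeneous_linForm b x).totalDegree (linForm_ne_zero b hx)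

theorem irreducible_linForm (b : Module.Basis (Fin l) ℂ V) {x : Module.Dual ℂ V} (hx : x ≠ 0) :
    Irreducible (linForm b x) := by
  -- In degree one, the only obstruction to irreducibility is a nonunit constant dividing every
  -- coefficient; over a field that constant is 0, which forces x = 0.
  refine MvPolynomial.irreducible_of_totalDegree_eq_one (totalDegree_linForm b hx) fun c hc => ?_
  rw [isUnit_iff_ne_zero]
  rintro rfl
  refine hx (b.ext fun i => ?_)
  rw [← coeff_linForm, zero_dvd_iff.mp (hc _)]
  rfl

theorem prime_linForm (b : Module.Basis (Fin l) ℂ V) {x : Module.Dual ℂ V} (hx : x ≠ 0) :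
    Prime (linForm b x) :=
  (irreducible_linForm b hx).prime

theorem ker_eq_of_linForm_dvd (b : Module.Basis (Fin l) ℂ V) {x y : Module.Dual ℂ V} (hx : x ≠ 0)
    (hy : y ≠ 0) (h : linForm b x ∣ linForm b y) : LinearMap.ker x = LinearMap.ker y := by
  obtain ⟨u, hu⟩ := (irreducible_linForm b hx).associated_of_dvd (irreducible_linForm b hy) h
  obtain ⟨c, hc, hcu⟩ := MvPolynomial.isUnit_iff_eq_C_of_isReduced.mp u.isUnit
  have hxy : c • x = y := linForm_injective b <| by rw [linForm_smul, ← hcu, mul_comm, hu]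
  rw [← hxy, LinearMap.ker_smul _ _ hc.ne_zero]

/-- A linear form vanishing on the kernel of `x` is a multiple of `x`. -/
theorem linForm_dvd_of_ker_le (b : Module.Basis (Fin l) ℂ V) {x y : Module.Dual ℂ V}
    (h : LinearMap.ker x ≤ LinearMap.ker y) : linForm b x ∣ linForm b y := by
  obtain ⟨c, rfl⟩ : ∃ c : ℂ, y = c • x := by
    have hy : y ∈ Submodule.span ℂ (Set.range fun _ : Unit => x) :=
      mem_span_of_iInf_ker_le_ker (by simpa using h)
    rw [Set.range_const, Submodule.mem_span_singleton] at hy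
    exact hy.imp fun _ h => h.symm
  rw [linForm_smul]
  exact dvd_mul_left _ _

theorem dirDeriv_linForm (b : Module.Basis (Fin l) ℂ V) (v : V) (x : Module.Dual ℂ V) :
    dirDeriv b v (linForm b x) = MvPolynomial.C (x v) := by
  conv_rhs => rw [← b.sum_repr v]
  simp only [linForm, dirDeriv, map_sum, Derivation.leibniz, MvPolynomial.mkDerivation_X,
    MvPolynomial.derivation_C, smul_eq_mul, mul_zero, add_zero, map_smul, map_mul]
  exact Finset.sum_congr rfl fun i _ => mul_comm _ _

theorem polyAct_linForm (b : Module.Basis (Fin l) ℂ V) (w : V ≃ₗ[ℂ] V) (x : Module.Dual ℂ V) :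
    polyAct b w (linForm b x) = linForm b (x ∘ₗ (w⁻¹ : V ≃ₗ[ℂ] V).toLinearMap) := by
  have hx : x ∘ₗ (w⁻¹ : V ≃ₗ[ℂ] V).toLinearMap =
      ∑ i, x (b i) • (b.coord i ∘ₗ (w⁻¹ : V ≃ₗ[ℂ] V).toLinearMap) := by
    ext v
    conv_lhs => rw [LinearMap.comp_apply, ← b.sum_repr ((w⁻¹ : V ≃ₗ[ℂ] V).toLinearMap v), map_sum]
    simp [mul_comm]
  let L : Module.Dual ℂ V →+ Poly l := ⟨⟨linForm b, by simp [linForm]⟩, linForm_add b⟩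
  have hL : linForm b (∑ i, x (b i) • (b.coord i ∘ₗ (w⁻¹ : V ≃ₗ[ℂ] V).toLinearMap)) =
      ∑ i, linForm b (x (b i) • (b.coord i ∘ₗ (w⁻¹ : V ≃ₗ[ℂ] V).toLinearMap)) := map_sum L _ _
  rw [hx, hL]
  simp only [linForm_smul]
  conv_lhs => rw [linForm]
  simp [polyAct]

theorem polyAct_mul (b : Module.Basis (Fin l) ℂ V) (w w' : V ≃ₗ[ℂ] V) (f : Poly l) :
    polyAct b (w * w') f = polyAct b w (polyAct b w' f) := by
  refine DFunLike.congr_fun (?_ : _ = (polyAct b w).comp (polyAct b w')) f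
  refine MvPolynomial.algHom_ext fun i => ?_
  rw [AlgHom.comp_apply, ← linForm_coord b, polyAct_linForm, polyAct_linForm, polyAct_linForm,
    mul_inv_rev]
  rfl

theorem polyAct_one (b : Module.Basis (Fin l) ℂ V) (f : Poly l) : polyAct b 1 f = f := by
  refine DFunLike.congr_fun (?_ : _ = AlgHom.id ℂ (Poly l)) f
  refine MvPolynomial.algHom_ext fun i => ?_
  rw [← linForm_coord b, polyAct_linForm, inv_one]
  rfl

theorem totalDegree_polyAct_le (b : Module.Basis (Fin l) ℂ V) (w : V ≃ₗ[ℂ] V) (f : Poly l) :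
    (polyAct b w f).totalDegree ≤ f.totalDegree := by
  rw [polyAct, MvPolynomial.aeval_def, MvPolynomial.eval₂_eq]
  refine MvPolynomial.totalDegree_finsetSum_le fun d hd => ?_
  refine (MvPolynomial.totalDegree_mul _ _).trans ?_
  rw [MvPolynomial.algebraMap_eq, MvPolynomial.totalDegree_C, zero_add]
  refine (MvPolynomial.totalDegree_finsetProd _ _).trans ?_
  refine le_trans (Finset.sum_le_sum fun i _ => ?_) (MvPolynomial.le_totalDegree hd)
  refine (MvPolynomial.totalDegree_pow _ _).trans ?_
  exact mul_le_of_le_one_right (Nat.zero_le _) (isHomogeneous_linForm b _).totalDegree_le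

/-- If `w` fixes the kernel of `x` pointwise, it acts trivially on `S` modulo `x`. -/
theorem linForm_dvd_polyAct_sub (b : Module.Basis (Fin l) ℂ V) {w : V ≃ₗ[ℂ] V}
    {x : Module.Dual ℂ V} (hw : ∀ v, x v = 0 → w v = v) (f : Poly l) :
    linForm b x ∣ polyAct b w f - f := by
  induction f using MvPolynomial.induction_on with
  | C c => simp [← MvPolynomial.algebraMap_eq]
  | add f g hf hg =>
    rw [map_add, add_sub_add_comm]
    exact dvd_add hf hg
  | mul_X f i hf =>
    have hi : linForm b x ∣ polyAct b w (MvPolynomial.X i) - MvPolynomial.X i := by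
      rw [← linForm_coord b, polyAct_linForm, ← linForm_sub]
      refine linForm_dvd_of_ker_le b fun v hv => ?_
      have : w.symm v = v := by rw [LinearEquiv.symm_apply_eq, hw v hv]
      simp [LinearMap.mem_ker, this]
    rw [map_mul, show polyAct b w f * polyAct b w (MvPolynomial.X i) - f * MvPolynomial.X i =
      (polyAct b w f - f) * polyAct b w (MvPolynomial.X i) +
      f * (polyAct b w (MvPolynomial.X i) - MvPolynomial.X i) by ring]
    exact dvd_add (hf.mul_right _) (hi.mul_left _)

end Coordinates

/-! ### Alternating maps and hyperplanes -/

section Alternating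

variable {V N : Type*} [AddCommGroup V] [Module ℂ V] [AddCommGroup N] [Module ℂ N]

/-- Pass to the quotient by U: an alternating map vanishing on tuples of distinct basis vectors is
zero. -/
theorem alternating_mem_of_basis {ι ι' : Type*} [Finite ι] (e : Module.Basis ι' ℂ V)
    (U : Submodule ℂ N) (ψ : V [⋀^ι]→ₗ[ℂ] N)
    (h : ∀ r : ι → ι', Function.Injective r → ψ (fun i => e (r i)) ∈ U) (v : ι → V) : ψ v ∈ U := by
  have h0 : U.mkQ.compAlternatingMap ψ = 0 := e.ext_alternating fun r hr => by
    simpa using h r hr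
  have hv := DFunLike.congr_fun h0 v
  simpa using hv

/-- An alternating map takes values in `U` if it does so on tuples from a hyperplane, and on tuples
all but one of whose entries belong to the hyperplane, the other one being a fixed vector outside of
it. -/
theorem alternating_mem_of_hyperplane [FiniteDimensional ℂ V] {ι : Type*} [Finite ι]
    {x : Module.Dual ℂ V} {a : V} (ha : x a ≠ 0) (U : Submodule ℂ N) (ψ : V [⋀^ι]→ₗ[ℂ] N)
    (h0 : ∀ v : ι → V, (∀ i, x (v i) = 0) → ψ v ∈ U)
    (h1 : ∀ (v : ι → V) (i : ι), v i = a → (∀ j, j ≠ i → x (v j) = 0) → ψ v ∈ U)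
    (v : ι → V) : ψ v ∈ U := by
  let e := Module.Basis.mkFinCons a (Module.finBasis ℂ (LinearMap.ker x))
    (fun c y hy hc => by
      have := congrArg x hc
      rw [map_add, map_smul, LinearMap.mem_ker.mp hy] at this
      simpa [ha] using this)
    (fun z => ⟨-(x z / x a), by simp [ha]⟩)
  have he : ∀ j, j ≠ 0 → x (e j) = 0 := fun j hj => by
    obtain ⟨k, rfl⟩ := Fin.exists_succ_eq.mpr hj
    simp [e]
  refine alternating_mem_of_basis e U ψ (fun r hr => ?_) v
  -- The basis is `a` followed by a basis of the hyperplane. As r is injective, `a` occurs at most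
  -- once.
  by_cases hi : ∃ i, r i = 0
  · obtain ⟨i, hi⟩ := hi
    refine h1 _ i (by simp [hi, e]) fun j hj => he _ fun h => hj (hr (h.trans hi.symm))
  · push Not at hi
    exact h0 _ fun i => he _ (hi i)

/-- Division of an alternating map by a ring element dividing all its values. -/
theorem exists_eq_smul_of_forall_dvd {A ι : Type*} [CommRing A] [IsDomain A] [Algebra ℂ A] {q : A}
    (hq : q ≠ 0) (ψ : V [⋀^ι]→ₗ[ℂ] A) (h : ∀ v, q ∣ ψ v) :
    ∃ ζ : V [⋀^ι]→ₗ[ℂ] A, ψ = q • ζ := by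
  choose g hg using h
  refine ⟨⟨⟨g, fun {_} v i x y => mul_left_cancel₀ hq ?_, fun {_} v i c x => mul_left_cancel₀ hq ?_⟩,
    fun v i j hv hij => mul_left_cancel₀ hq ?_⟩, AlternatingMap.ext hg⟩
  · rw [mul_add, ← hg, ← hg, ← hg, ψ.map_update_add]
  · rw [mul_smul_comm, ← hg, ← hg, ψ.map_update_smul]
  · rw [← hg, ψ.map_eq_zero_of_eq v hv hij]
    simp

end Alternating

/-! ### Numerators of logarithmic forms -/

section LogForms

variable {V : Type*} [AddCommGroup V] [Module ℂ V] {l p : ℕ}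

theorem divForm_apply (Q : Poly l) (η : PolyForm V l p) (v : Fin p → V) :
    divForm Q p η v = (algebraMap (Poly l) (RatFun l) Q)⁻¹ * algebraMap (Poly l) (RatFun l) (η v) :=
  rfl

theorem divForm_injective {Q : Poly l} (hQ : Q ≠ 0) :
    Function.Injective (divForm (V := V) Q p) := by
  intro η ζ h
  ext1 v
  have hv := DFunLike.congr_fun h v
  have hQ' : algebraMap (Poly l) (RatFun l) Q ≠ 0 := by
    rwa [Ne, map_eq_zero_iff _ (IsFractionRing.injective (Poly l) (RatFun l))]
  rw [divForm_apply, divForm_apply] at hv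
  exact IsFractionRing.injective (Poly l) (RatFun l) (mul_left_cancel₀ (inv_ne_zero hQ') hv)

/-- The differential of a polynomial function. -/
def differential (b : Module.Basis (Fin l) ℂ V) (f : Poly l) : V →ₗ[ℂ] Poly l where
  toFun := fun v => dirDeriv b v f
  map_add' := fun v w => by rw [dirDeriv_add]; rfl
  map_smul' := fun c v => by rw [dirDeriv_smul]; rfl

/-- The wedge product of a one-form and a `p`-form. -/
def oneWedge (x : V →ₗ[ℂ] Poly l) (η : PolyForm V l p) : PolyForm V l (p + 1) :=
  AlternatingMap.alternatizeUncurryFin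
    { toFun := fun v => x v • η
      map_add' := fun v w => by rw [map_add, add_smul]
      map_smul' := fun c v => by
        ext1 u
        rw [map_smul]
        exact smul_assoc c (x v) (η u) }

theorem oneWedge_apply (x : V →ₗ[ℂ] Poly l) (η : PolyForm V l p) (v : Fin (p + 1) → V) :
    oneWedge x η v = ∑ i : Fin (p + 1), (-1) ^ (i : ℕ) • (x (v i) * η (i.removeNth v)) := by
  rw [oneWedge, AlternatingMap.alternatizeUncurryFin_apply]
  rfl

/-- The exterior derivative of polynomial forms. -/
def polyExtDer (b : Module.Basis (Fin l) ℂ V) (η : PolyForm V l p) : PolyForm V l (p + 1) :=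
  AlternatingMap.alternatizeUncurryFin
    { toFun := fun v => ((dirDeriv b v : Poly l →ₗ[ℂ] Poly l)).compAlternatingMap η
      map_add' := fun v w => by
        ext u : 1
        simp [dirDeriv_add]
      map_smul' := fun c v => by
        ext u : 1
        simp [dirDeriv_smul] }

theorem ratDeriv_algebraMap (b : Module.Basis (Fin l) ℂ V) (v : V) (f : Poly l) :
    ratDeriv b v (algebraMap (Poly l) (RatFun l) f) =
      algebraMap (Poly l) (RatFun l) (dirDeriv b v f) :=
  quotientRule_algebraMap _ _

/-- The quotient rule d(η/Q) = dη/Q - (dQ ∧ η)/Q², checked summand by summand. -/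
theorem extDer_divForm (b : Module.Basis (Fin l) ℂ V) {Q : Poly l} (η : PolyForm V l p) :
    extDer b (divForm Q p η) = divForm Q (p + 1) (polyExtDer b η) -
      (algebraMap (Poly l) (RatFun l) Q)⁻¹ • divForm Q (p + 1) (oneWedge (differential b Q) η) := by
  ext1 v
  rw [AlternatingMap.sub_apply, AlternatingMap.smul_apply, divForm_apply, divForm_apply,
    oneWedge_apply, extDer, polyExtDer, AlternatingMap.alternatizeUncurryFin_apply,
    AlternatingMap.alternatizeUncurryFin_apply, map_sum, map_sum, Finset.mul_sum, Finset.mul_sum,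
    smul_eq_mul, Finset.mul_sum, ← Finset.sum_sub_distrib]
  refine Finset.sum_congr rfl fun i _ => ?_
  rw [map_zsmul, map_zsmul, zsmul_eq_mul, zsmul_eq_mul, zsmul_eq_mul]
  change _ * ratDeriv b (v i) (divForm Q p η _) =
    _ * (_ * algebraMap _ _ (dirDeriv b (v i) (η _))) -
      _ * (_ * (_ * algebraMap _ _ (dirDeriv b (v i) Q * _)))
  rw [divForm_apply, Derivation.leibniz, Derivation.leibniz_inv, ratDeriv_algebraMap,
    ratDeriv_algebraMap, map_mul, smul_eq_mul, smul_eq_mul, smul_eq_mul]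
  ring

/-- In the quotient rule dη/Q already has the allowed pole, so only (dQ ∧ η)/Q² matters. -/
theorem divForm_mem_logForms (b : Module.Basis (Fin l) ℂ V) {Q : Poly l} (hQ : Q ≠ 0)
    (η : PolyForm V l p) :
    divForm Q p η ∈ logForms b Q p ↔ ∀ v, Q ∣ oneWedge (differential b Q) η v := by
  have hQ' : algebraMap (Poly l) (RatFun l) Q ≠ 0 := by
    rwa [Ne, map_eq_zero_iff _ (IsFractionRing.injective (Poly l) (RatFun l))]
  have key : ∀ ζ : PolyForm V l (p + 1), (algebraMap (Poly l) (RatFun l) Q)⁻¹ •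
      divForm Q (p + 1) (Q • ζ) = divForm Q (p + 1) ζ := fun ζ => by
    ext1 v
    rw [AlternatingMap.smul_apply, divForm_apply, divForm_apply, AlternatingMap.smul_apply,
      smul_eq_mul, smul_eq_mul, map_mul, inv_mul_cancel_left₀ hQ']
  constructor
  · rintro ⟨-, ζ, hζ⟩ v
    rw [extDer_divForm, sub_eq_iff_eq_add, ← sub_eq_iff_eq_add', ← map_sub, ← key] at hζ
    have := divForm_injective hQ (smul_right_injective _ (inv_ne_zero hQ') hζ)
    rw [← this]
    exact dvd_mul_right Q _
  · intro h
    obtain ⟨ζ, hζ⟩ := exists_eq_smul_of_forall_dvd hQ _ h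
    refine ⟨⟨η, rfl⟩, polyExtDer b η - ζ, ?_⟩
    rw [extDer_divForm, hζ, key, map_sub]

/-- The forms whose restriction to each of the hyperplanes `ker (x H)` is divisible by `x H`. -/
def logNumerators {ι : Type*} (b : Module.Basis (Fin l) ℂ V) (x : ι → Module.Dual ℂ V) (p : ℕ) :
    Submodule (Poly l) (PolyForm V l p) where
  carrier := {η | ∀ H, ∀ v : Fin p → V, (∀ i, x H (v i) = 0) → linForm b (x H) ∣ η v}
  add_mem' := fun hη hζ H v hv => dvd_add (hη H v hv) (hζ H v hv)
  zero_mem' := fun _ _ _ => dvd_zero _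
  smul_mem' := fun f _ hη H v hv => (hη H v hv).mul_left f

theorem linForm_isRelPrime (b : Module.Basis (Fin l) ℂ V) {x y : Module.Dual ℂ V} (hx : x ≠ 0)
    (hy : y ≠ 0) (h : LinearMap.ker x ≠ LinearMap.ker y) :
    IsRelPrime (linForm b x) (linForm b y) :=
  (irreducible_linForm b hx).isRelPrime_iff_not_dvd.mpr fun hd =>
    h (ker_eq_of_linForm_dvd b hx hy hd)

theorem divForm_mem_logForms_iff {ι : Type*} [Fintype ι] (b : Module.Basis (Fin l) ℂ V)
    (x : ι → Module.Dual ℂ V) (hx : ∀ H, x H ≠ 0)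
    (hinj : Function.Injective fun H => LinearMap.ker (x H)) (η : PolyForm V l p) :
    divForm (∏ H, linForm b (x H)) p η ∈ logForms b (∏ H, linForm b (x H)) p ↔
      η ∈ logNumerators b x p := by
  classical
  have : FiniteDimensional ℂ V := Module.Basis.finiteDimensional_of_finite b
  rw [divForm_mem_logForms b (Finset.prod_ne_zero_iff.mpr fun H _ => linForm_ne_zero b (hx H))]
  -- Leibniz rule for Q = α_H · ∏_{K ≠ H} α_K. In particular α_H divides ∂_v Q for every v in H.
  have hsplit : ∀ H v, ∃ r, dirDeriv b v (∏ H, linForm b (x H)) =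
      (∏ K ∈ Finset.univ.erase H, linForm b (x K)) * MvPolynomial.C (x H v) +
        linForm b (x H) * r := fun H v => by
    refine ⟨dirDeriv b v (∏ K ∈ Finset.univ.erase H, linForm b (x K)), ?_⟩
    rw [← Finset.mul_prod_erase _ _ (Finset.mem_univ H), Derivation.leibniz, dirDeriv_linForm,
      smul_eq_mul, smul_eq_mul, add_comm]
  have hmem : ∀ H (f : Poly l), f ∈ (Ideal.span {linForm b (x H)}).restrictScalars ℂ ↔
      linForm b (x H) ∣ f := fun H f => Ideal.mem_span_singleton
  constructor
  · intro h H v hv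
    obtain ⟨u, hu⟩ := DFunLike.ne_iff.mp (hx H)
    -- Test dQ ∧ η on (u, v) with u outside H and v in H: every term but the first contains some
    -- ∂_{v_i} Q, hence α_H. The first is (∏_{K ≠ H} α_K) α_H(u) η(v) modulo α_H, and α_H is prime
    -- to the first two factors.
    have hdvd := (Finset.dvd_prod_of_mem (fun K => linForm b (x K)) (Finset.mem_univ H)).trans
      (h (Fin.cons u v))
    rw [oneWedge_apply, Fin.sum_univ_succ] at hdvd
    have htail : linForm b (x H) ∣ ∑ i : Fin p, (-1) ^ (i.succ : ℕ) •
        (differential b (∏ H, linForm b (x H)) ((Fin.cons u v : Fin (p + 1) → V) i.succ) *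
          η (i.succ.removeNth (Fin.cons u v : Fin (p + 1) → V))) := by
      refine Finset.dvd_sum fun i _ => ?_
      obtain ⟨r, hr⟩ := hsplit H (v i)
      rw [hv i, map_zero, mul_zero, zero_add] at hr
      refine dvd_smul_of_dvd _ (Dvd.dvd.mul_right ?_ _)
      exact hr ▸ dvd_mul_right _ r
    rw [dvd_add_left htail] at hdvd
    obtain ⟨r, hr⟩ := hsplit H u
    have hhead : linForm b (x H) ∣ ((∏ K ∈ Finset.univ.erase H, linForm b (x K)) *
        MvPolynomial.C (x H u) + linForm b (x H) * r) * η v := by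
      rw [← hr]
      simpa [differential] using hdvd
    rw [add_mul, dvd_add_left (Dvd.dvd.mul_right (dvd_mul_right _ r) _), mul_assoc] at hhead
    have hprime := prime_linForm b (hx H)
    rcases hprime.dvd_or_dvd hhead with h1 | h1
    · obtain ⟨K, hK, hd⟩ := hprime.exists_mem_finset_dvd h1
      exact absurd (hinj (ker_eq_of_linForm_dvd b (hx H) (hx K) hd)).symm (Finset.ne_of_mem_erase hK)
    · refine (hprime.dvd_or_dvd h1).resolve_left fun h2 => hprime.not_isUnit ?_
      exact isUnit_of_dvd_unit h2 ((isUnit_iff_ne_zero.mpr hu).map MvPolynomial.C)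
  · intro h v
    refine Finset.prod_dvd_of_isRelPrime (fun H _ K _ hHK =>
      linForm_isRelPrime b (hx H) (hx K) (hinj.ne hHK)) fun H _ => ?_
    obtain ⟨u, hu⟩ := DFunLike.ne_iff.mp (hx H)
    rw [← hmem]
    refine alternating_mem_of_hyperplane hu _ _ (fun v hv => ?_) (fun v i _ hv => ?_) v
    all_goals
      rw [hmem, oneWedge_apply]
      refine Finset.dvd_sum fun j _ => dvd_smul_of_dvd _ ?_
      obtain ⟨r, hr⟩ := hsplit H (v j)
    · rw [hv j, map_zero, mul_zero, zero_add] at hr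
      refine Dvd.dvd.mul_right ?_ _
      exact hr ▸ dvd_mul_right _ r
    · by_cases hj : j = i
      · subst hj
        exact (h H _ fun k => hv _ (Fin.succAbove_ne j k)).mul_left _
      · rw [hv j hj, map_zero, mul_zero, zero_add] at hr
        refine Dvd.dvd.mul_right ?_ _
        exact hr ▸ dvd_mul_right _ r

end LogForms

/-! ### The twisted action on forms -/

section TwistedAction

variable {V : Type*} [AddCommGroup V] [Module ℂ V] {l p : ℕ}

/-- The action on `Ω^p`, twisted by the determinant; its invariants are the anti-invariant forms. -/
def twistAct (b : Module.Basis (Fin l) ℂ V) (p : ℕ) (w : V ≃ₗ[ℂ] V) :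
    PolyForm V l p →ₗ[ℂ] PolyForm V l p where
  toFun := fun η => LinearMap.det (w : V →ₗ[ℂ] V) • formAct b w η
  map_add' := fun η ζ => by
    rw [← smul_add]
    ext u : 1
    simp [formAct]
  map_smul' := fun c η => by
    rw [RingHom.id_apply, smul_comm]
    congr 1
    ext u : 1
    simp [formAct]

theorem twistAct_apply (b : Module.Basis (Fin l) ℂ V) (w : V ≃ₗ[ℂ] V) (η : PolyForm V l p)
    (v : Fin p → V) : twistAct b p w η v =
      LinearMap.det (w : V →ₗ[ℂ] V) • polyAct b w (η fun i => w.symm (v i)) :=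
  rfl

theorem twistAct_mul (b : Module.Basis (Fin l) ℂ V) (w w' : V ≃ₗ[ℂ] V) (η : PolyForm V l p) :
    twistAct b p (w * w') η = twistAct b p w (twistAct b p w' η) := by
  ext1 v
  have hdet : LinearMap.det ((w * w' : V ≃ₗ[ℂ] V) : V →ₗ[ℂ] V) =
      LinearMap.det (w : V →ₗ[ℂ] V) * LinearMap.det (w' : V →ₗ[ℂ] V) :=
    map_mul LinearMap.det (w : V →ₗ[ℂ] V) (w' : V →ₗ[ℂ] V)
  simp only [twistAct_apply, polyAct_mul, map_smul, hdet, mul_smul]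
  rfl

theorem twistAct_one (b : Module.Basis (Fin l) ℂ V) (η : PolyForm V l p) :
    twistAct b p 1 η = η := by
  ext1 v
  have hdet : LinearMap.det ((1 : V ≃ₗ[ℂ] V) : V →ₗ[ℂ] V) = 1 := map_one LinearMap.det
  rw [twistAct_apply, polyAct_one, hdet, one_smul]
  rfl

theorem twistAct_poly_smul (b : Module.Basis (Fin l) ℂ V) (w : V ≃ₗ[ℂ] V) (f : Poly l)
    (η : PolyForm V l p) : twistAct b p w (f • η) = polyAct b w f • twistAct b p w η := by
  ext1 v
  simp only [twistAct_apply, AlternatingMap.smul_apply, smul_eq_mul, map_mul, mul_smul_comm]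

theorem mem_antiInvariants_iff (b : Module.Basis (Fin l) ℂ V) (W : Subgroup (V ≃ₗ[ℂ] V))
    (η : PolyForm V l p) : η ∈ antiInvariants b W p ↔ ∀ w ∈ W, twistAct b p w η = η := by
  refine forall₂_congr fun w _ => ?_
  have hdet : LinearMap.det (w : V →ₗ[ℂ] V) ≠ 0 := (LinearEquiv.isUnit_det' w).ne_zero
  exact eq_inv_smul_iff₀ hdet

/-- `f` is zero or of degree less than `d`. -/
def degreeLT (l d : ℕ) : Submodule ℂ (Poly l) where
  -- The zero polynomial has total degree 0, so it must be admitted separately; then d = 0 leaves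
  -- exactly 0, the base case of both descents.
  carrier := {f | f = 0 ∨ f.totalDegree < d}
  add_mem' := by
    rintro f g (rfl | hf) (rfl | hg)
    · simp
    · simpa using .inr hg
    · simpa using .inr hf
    · exact .inr ((MvPolynomial.totalDegree_add f g).trans_lt (max_lt hf hg))
  zero_mem' := .inl rfl
  smul_mem' := by
    rintro c f (rfl | hf)
    · simp
    · exact .inr ((MvPolynomial.totalDegree_smul_le c f).trans_lt hf)

theorem degreeLT_mono {d e : ℕ} (h : d ≤ e) : degreeLT l d ≤ degreeLT l e :=
  fun _ hf => hf.imp_right fun hf => hf.trans_le h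

theorem mem_degreeLT_succ (f : Poly l) : f ∈ degreeLT l (f.totalDegree + 1) :=
  .inr (Nat.lt_succ_self _)

theorem eq_zero_of_mem_degreeLT_zero {f : Poly l} (h : f ∈ degreeLT l 0) : f = 0 :=
  h.resolve_right (Nat.not_lt_zero _)

theorem polyAct_mem_degreeLT (b : Module.Basis (Fin l) ℂ V) (w : V ≃ₗ[ℂ] V) {d : ℕ} {f : Poly l}
    (h : f ∈ degreeLT l d) : polyAct b w f ∈ degreeLT l d := by
  rcases h with rfl | h
  · simp
  · exact .inr ((totalDegree_polyAct_le b w f).trans_lt h)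

theorem mem_degreeLT_of_linForm_mul (b : Module.Basis (Fin l) ℂ V) {x : Module.Dual ℂ V}
    (hx : x ≠ 0) {d : ℕ} {f : Poly l} (h : linForm b x * f ∈ degreeLT l (d + 1)) :
    f ∈ degreeLT l d := by
  by_cases hf : f = 0
  · exact .inl hf
  have h' := h.resolve_left (mul_ne_zero (linForm_ne_zero b hx) hf)
  rw [MvPolynomial.totalDegree_mul_of_isDomain (linForm_ne_zero b hx) hf,
    totalDegree_linForm b hx] at h'
  exact .inr (by omega)

/-- All values are controlled by the finitely many values on tuples of basis vectors. -/
theorem exists_forall_mem_degreeLT (b : Module.Basis (Fin l) ℂ V) (η : PolyForm V l p) :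
    ∃ d, ∀ v, η v ∈ degreeLT l d := by
  refine ⟨(Finset.univ.sup fun r : Fin p → Fin l => (η fun i => b (r i)).totalDegree) + 1,
    alternating_mem_of_basis b _ η fun r _ => ?_⟩
  refine .inr (Nat.lt_succ_of_le ?_)
  exact Finset.le_sup (f := fun r : Fin p → Fin l => (η fun i => b (r i)).totalDegree)
    (Finset.mem_univ r)

theorem twistAct_mem_degreeLT (b : Module.Basis (Fin l) ℂ V) (w : V ≃ₗ[ℂ] V) {d : ℕ}
    {η : PolyForm V l p} (h : ∀ v, η v ∈ degreeLT l d) (v : Fin p → V) :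
    twistAct b p w η v ∈ degreeLT l d :=
  Submodule.smul_mem _ _ (polyAct_mem_degreeLT b w (h _))

end TwistedAction

/-! ### Forms and a single reflection -/

section SingleReflection

variable {V : Type*} [AddCommGroup V] [Module ℂ V] {l p : ℕ}

/-- `s` is a diagonalizable reflection with hyperplane `ker x` and root `a`. -/
structure IsReflectionWith (s : V ≃ₗ[ℂ] V) (x : Module.Dual ℂ V) (a : V) : Prop where
  apply_root : s a = LinearMap.det (s : V →ₗ[ℂ] V) • a
  dual_root_ne_zero : x a ≠ 0
  det_ne_one : LinearMap.det (s : V →ₗ[ℂ] V) ≠ 1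
  apply_of_dual_eq_zero : ∀ v, x v = 0 → s v = v

namespace IsReflectionWith

variable {s : V ≃ₗ[ℂ] V} {x : Module.Dual ℂ V} {a : V}

theorem dual_ne_zero (h : IsReflectionWith s x a) : x ≠ 0 := by
  rintro rfl
  exact h.dual_root_ne_zero rfl

theorem det_ne_zero (_h : IsReflectionWith s x a) : LinearMap.det (s : V →ₗ[ℂ] V) ≠ 0 :=
  (LinearEquiv.isUnit_det' s).ne_zero

theorem dual_apply (h : IsReflectionWith s x a) (v : V) :
    x (s v) = LinearMap.det (s : V →ₗ[ℂ] V) * x v := by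
  have hv := h.apply_of_dual_eq_zero (v - (x v / x a) • a)
    (by simp [h.dual_root_ne_zero])
  have hxv := congrArg x hv
  rw [map_sub, map_smul, h.apply_root] at hxv
  simp only [map_sub, map_smul, smul_eq_mul] at hxv
  have := h.dual_root_ne_zero
  field_simp at hxv
  linear_combination hxv

theorem symm_apply_of_dual_eq_zero (h : IsReflectionWith s x a) {v : V} (hv : x v = 0) :
    s.symm v = v := by
  rw [LinearEquiv.symm_apply_eq, h.apply_of_dual_eq_zero v hv]

theorem symm_apply_root (h : IsReflectionWith s x a) :
    s.symm a = (LinearMap.det (s : V →ₗ[ℂ] V))⁻¹ • a := by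
  rw [LinearEquiv.symm_apply_eq, map_smul, h.apply_root, smul_smul, inv_mul_cancel₀ h.det_ne_zero,
    one_smul]

/-- The form x is an eigenvector of s with eigenvalue det(s)⁻¹, which the twist cancels. -/
theorem det_smul_polyAct_linForm (h : IsReflectionWith s x a) (b : Module.Basis (Fin l) ℂ V) :
    LinearMap.det (s : V →ₗ[ℂ] V) • polyAct b s (linForm b x) = linForm b x := by
  rw [polyAct_linForm, MvPolynomial.smul_eq_C_mul, ← linForm_smul]
  congr 1
  ext v
  change LinearMap.det (s : V →ₗ[ℂ] V) * x (s.symm v) = x v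
  rw [← h.dual_apply, s.apply_symm_apply]

theorem linForm_dvd_polyAct_sub (h : IsReflectionWith s x a) (b : Module.Basis (Fin l) ℂ V)
    (f : Poly l) : linForm b x ∣ polyAct b s f - f :=
  UnitaryReflection.linForm_dvd_polyAct_sub b h.apply_of_dual_eq_zero f

theorem twistAct_apply_of_dual_eq_zero (h : IsReflectionWith s x a) (b : Module.Basis (Fin l) ℂ V)
    (η : PolyForm V l p) {v : Fin p → V} (hv : ∀ i, x (v i) = 0) :
    twistAct b p s η v = LinearMap.det (s : V →ₗ[ℂ] V) • polyAct b s (η v) := by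
  rw [twistAct_apply]
  congr 3
  exact funext fun i => h.symm_apply_of_dual_eq_zero (hv i)

/-- On tuples from the hyperplane s acts only on the value, and trivially modulo x. So η v ≡ det(s)
η v modulo x, and 1 - det(s) is invertible. -/
theorem linForm_dvd_of_twistAct_eq (h : IsReflectionWith s x a) (b : Module.Basis (Fin l) ℂ V)
    {η : PolyForm V l p} (hη : twistAct b p s η = η) {v : Fin p → V} (hv : ∀ i, x (v i) = 0) :
    linForm b x ∣ η v := by
  have h1 := h.twistAct_apply_of_dual_eq_zero b η hv
  rw [hη] at h1
  have h2 := dvd_smul_of_dvd (LinearMap.det (s : V →ₗ[ℂ] V)) (h.linForm_dvd_polyAct_sub b (η v))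
  rw [smul_sub, ← h1] at h2
  have h3 : η v - LinearMap.det (s : V →ₗ[ℂ] V) • η v =
      (1 - LinearMap.det (s : V →ₗ[ℂ] V)) • η v := by rw [sub_smul, one_smul]
  rw [h3] at h2
  have h4 := dvd_smul_of_dvd (1 - LinearMap.det (s : V →ₗ[ℂ] V))⁻¹ h2
  rwa [smul_smul, inv_mul_cancel₀ (sub_ne_zero.mpr h.det_ne_one.symm), one_smul] at h4

/-- On tuples from the hyperplane both terms are divisible. If one entry is the root, s⁻¹ scales it
by det(s)⁻¹; this cancels the twist and leaves sf - f with f = η v. -/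
theorem linForm_dvd_twistAct_sub (h : IsReflectionWith s x a) (b : Module.Basis (Fin l) ℂ V)
    {η : PolyForm V l p} (hη : ∀ v : Fin p → V, (∀ i, x (v i) = 0) → linForm b x ∣ η v)
    (v : Fin p → V) : linForm b x ∣ (twistAct b p s η - η) v := by
  classical
  have : FiniteDimensional ℂ V := Module.Basis.finiteDimensional_of_finite b
  have hmem : ∀ f : Poly l, f ∈ (Ideal.span {linForm b x}).restrictScalars ℂ ↔
      linForm b x ∣ f := fun f => Ideal.mem_span_singleton
  rw [← hmem]
  refine alternating_mem_of_hyperplane h.dual_root_ne_zero _ _ (fun v hv => ?_)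
    (fun v i hi hv => ?_) v
  · rw [hmem, AlternatingMap.sub_apply, h.twistAct_apply_of_dual_eq_zero b η hv]
    have h1 := hη v hv
    refine dvd_sub (dvd_smul_of_dvd _ ?_) h1
    exact (dvd_sub_left h1).mp (h.linForm_dvd_polyAct_sub b (η v))
  · have hupd : (fun j => s.symm (v j)) =
        Function.update v i ((LinearMap.det (s : V →ₗ[ℂ] V))⁻¹ • v i) := by
      funext j
      by_cases hj : j = i
      · subst hj
        rw [Function.update_self, hi, h.symm_apply_root]
      · rw [Function.update_of_ne hj, h.symm_apply_of_dual_eq_zero (hv j hj)]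
    rw [hmem, AlternatingMap.sub_apply, twistAct_apply, hupd, η.map_update_smul,
      Function.update_eq_self, map_smul, smul_smul, mul_inv_cancel₀ h.det_ne_zero, one_smul]
    exact h.linForm_dvd_polyAct_sub b (η v)

/-- If η v = x g, the twisted action sends x g to x · (s g), so θ v = s g - g, which x divides. -/
theorem linForm_dvd_of_twistAct_sub_eq (h : IsReflectionWith s x a) (b : Module.Basis (Fin l) ℂ V)
    {η θ : PolyForm V l p} (hη : ∀ v : Fin p → V, (∀ i, x (v i) = 0) → linForm b x ∣ η v)
    (hθ : twistAct b p s η - η = linForm b x • θ) {v : Fin p → V} (hv : ∀ i, x (v i) = 0) :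
    linForm b x ∣ θ v := by
  obtain ⟨g, hg⟩ := hη v hv
  have hθv := DFunLike.congr_fun hθ v
  rw [AlternatingMap.sub_apply, h.twistAct_apply_of_dual_eq_zero b η hv, hg, map_mul,
    ← smul_mul_assoc, h.det_smul_polyAct_linForm, ← mul_sub, AlternatingMap.smul_apply,
    smul_eq_mul] at hθv
  rw [← mul_left_cancel₀ (linForm_ne_zero b h.dual_ne_zero) hθv]
  exact h.linForm_dvd_polyAct_sub b g

end IsReflectionWith

end SingleReflection

/-! ### Unitary reflections -/

section Unitary

variable {V : Type*} [NormedAddCommGroup V] [InnerProductSpace ℂ V]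

theorem mem_fixedSpace {s : V ≃ₗ[ℂ] V} {v : V} : v ∈ fixedSpace s ↔ s v = v := by
  rw [fixedSpace, LinearMap.mem_ker]
  exact sub_eq_zero

/-- The root is a = su - u for any u off the hyperplane. Unitarity makes a orthogonal to the
hyperplane, so a is not in it; this gives x a ≠ 0 and det s = 1 + x a / x u ≠ 1. -/
theorem IsUnitaryReflection.exists_isReflectionWith [FiniteDimensional ℂ V] {s : V ≃ₗ[ℂ] V}
    (hs : IsUnitaryReflection s) {x : Module.Dual ℂ V} (hx : LinearMap.ker x = fixedSpace s) :
    ∃ a, IsReflectionWith s x a := by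
  have hfix : ∀ v, x v = 0 ↔ s v = v := fun v => by
    rw [← mem_fixedSpace, ← hx, LinearMap.mem_ker]
  have hx0 : x ≠ 0 := by
    rintro rfl
    have := hs.2
    rw [← hx, LinearMap.ker_zero, finrank_top] at this
    omega
  obtain ⟨u, hu⟩ := DFunLike.ne_iff.mp hx0
  change x u ≠ 0 at hu
  let a := s u - u
  have hsv : ∀ v, s v = v + (x v / x u) • a := fun v => by
    have h := (hfix (v - (x v / x u) • u)).mp (by simp [hu])
    rw [map_sub, map_smul, sub_eq_iff_eq_add] at h
    rw [h, smul_sub]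
    abel
  have hperp : ∀ v, x v = 0 → inner ℂ v a = 0 := fun v hv => by
    have h := hs.1 v u
    rw [(hfix v).mp hv] at h
    rw [inner_sub_right, h, sub_self]
  have ha : x a ≠ 0 := fun h => by
    have h0 : a = 0 := inner_self_eq_zero.mp (hperp a h)
    exact hu ((hfix u).mpr (sub_eq_zero.mp h0))
  have hdet : LinearMap.det (s : V →ₗ[ℂ] V) = 1 + x a / x u := by
    have : (s : V →ₗ[ℂ] V) = LinearMap.transvection ((x u)⁻¹ • x) a := by
      ext v
      rw [LinearMap.transvection.apply, LinearEquiv.coe_coe, hsv v]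
      simp [div_eq_inv_mul]
    rw [this, LinearMap.transvection.det]
    simp [div_eq_inv_mul]
  refine ⟨a, ?_, ha, ?_, fun v hv => (hfix v).mp hv⟩
  · rw [hdet, hsv a, add_smul, one_smul]
  · rw [hdet]
    simpa using ⟨ha, hu⟩

theorem finite_arrangement {W : Subgroup (V ≃ₗ[ℂ] V)} (hW : Finite W) :
    (arrangement W).Finite := by
  refine ((Set.toFinite (W : Set (V ≃ₗ[ℂ] V))).image fixedSpace).subset ?_
  rintro H ⟨s, hs, -, rfl⟩
  exact ⟨s, hs, rfl⟩

/-- The arrangement is stable under the reflections in `W`. -/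
theorem comap_mem_arrangement {W : Subgroup (V ≃ₗ[ℂ] V)} {s : V ≃ₗ[ℂ] V} (hsW : s ∈ W)
    (hs : IsUnitaryReflection s) {H : Submodule ℂ V} (hH : H ∈ arrangement W) :
    H.comap (s : V →ₗ[ℂ] V) ∈ arrangement W := by
  obtain ⟨t, htW, ht, rfl⟩ := hH
  have hfix : fixedSpace (s⁻¹ * t * s) = (fixedSpace t).comap (s : V →ₗ[ℂ] V) := by
    ext v
    rw [mem_fixedSpace, Submodule.mem_comap, mem_fixedSpace]
    exact s.symm_apply_eq
  refine ⟨s⁻¹ * t * s, W.mul_mem (W.mul_mem (W.inv_mem hsW) htW) hsW, ⟨fun u v => ?_, ?_⟩, hfix⟩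
  · have hinv : ∀ u v : V, inner ℂ (s.symm u) (s.symm v) = inner ℂ u v := fun u v => by
      rw [← hs.1, s.apply_symm_apply, s.apply_symm_apply]
    change inner ℂ (s.symm (t (s u))) (s.symm (t (s v))) = _
    rw [hinv, ht.1, hs.1]
  · rw [hfix, ← ht.2]
    congr 1
    exact ((s.submoduleMap _).finrank_eq).trans (by
      rw [Submodule.map_comap_eq_of_surjective s.surjective])

end Unitary

/-! ### Anti-invariant forms generate the numerators of logarithmic forms -/

section Generation

variable {V : Type*} [NormedAddCommGroup V] [InnerProductSpace ℂ V] {l p : ℕ}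
  {b : Module.Basis (Fin l) ℂ V} {W : Subgroup (V ≃ₗ[ℂ] V)}
  {α : arrangement W → Module.Dual ℂ V}

theorem exists_isReflectionWith (b : Module.Basis (Fin l) ℂ V)
    (hα : ∀ H : arrangement W, LinearMap.ker (α H) = (H : Submodule ℂ V)) {s : V ≃ₗ[ℂ] V}
    (hsW : s ∈ W) (hs : IsUnitaryReflection s) : ∃ H a, IsReflectionWith s (α H) a := by
  have : FiniteDimensional ℂ V := Module.Basis.finiteDimensional_of_finite b
  let H : arrangement W := ⟨fixedSpace s, s, hsW, hs, rfl⟩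
  exact ⟨H, hs.exists_isReflectionWith (hα H)⟩

theorem exists_isReflectionWith_of_mem (b : Module.Basis (Fin l) ℂ V)
    (hα : ∀ H : arrangement W, LinearMap.ker (α H) = (H : Submodule ℂ V)) (H : arrangement W) :
    ∃ s ∈ W, ∃ a, IsReflectionWith s (α H) a := by
  have : FiniteDimensional ℂ V := Module.Basis.finiteDimensional_of_finite b
  obtain ⟨s, hsW, hs, hH⟩ := H.2
  exact ⟨s, hsW, hs.exists_isReflectionWith ((hα H).trans hH.symm)⟩

theorem dual_ne_zero (b : Module.Basis (Fin l) ℂ V)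
    (hα : ∀ H : arrangement W, LinearMap.ker (α H) = (H : Submodule ℂ V)) (H : arrangement W) :
    α H ≠ 0 := by
  obtain ⟨s, -, a, h⟩ := exists_isReflectionWith_of_mem b hα H
  exact h.dual_ne_zero

theorem ker_dual_injective
    (hα : ∀ H : arrangement W, LinearMap.ker (α H) = (H : Submodule ℂ V)) :
    Function.Injective fun H => LinearMap.ker (α H) := fun H K h =>
  Subtype.ext <| by rw [← hα H, ← hα K]; exact h

theorem antiInvariants_subset_logNumerators
    (hα : ∀ H : arrangement W, LinearMap.ker (α H) = (H : Submodule ℂ V)) :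
    (antiInvariants b W p : Set (PolyForm V l p)) ⊆ logNumerators b α p := by
  intro η hη H v hv
  obtain ⟨s, hsW, a, h⟩ := exists_isReflectionWith_of_mem b hα H
  exact h.linForm_dvd_of_twistAct_eq b ((mem_antiInvariants_iff b W η).mp hη s hsW) hv

/-- With K = s⁻¹H, again in the arrangement, divisibility by α_K on K is carried by s to
divisibility by α_H on H. -/
theorem twistAct_mem_logNumerators
    (hα : ∀ H : arrangement W, LinearMap.ker (α H) = (H : Submodule ℂ V)) {s : V ≃ₗ[ℂ] V}
    (hsW : s ∈ W) (hs : IsUnitaryReflection s) {η : PolyForm V l p}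
    (hη : η ∈ logNumerators b α p) : twistAct b p s η ∈ logNumerators b α p := by
  intro H v hv
  let K : arrangement W := ⟨_, comap_mem_arrangement hsW hs H.2⟩
  have hK : ∀ u, α K u = 0 ↔ α H (s u) = 0 := fun u => by
    rw [← LinearMap.mem_ker, ← LinearMap.mem_ker, hα H, hα K]
    rfl
  rw [twistAct_apply]
  refine dvd_smul_of_dvd _ (dvd_trans ?_ (map_dvd (polyAct b s) (hη K _ fun i => ?_)))
  · rw [polyAct_linForm]
    refine linForm_dvd_of_ker_le b fun u hu => ?_
    change α K (s.symm u) = 0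
    rw [hK, s.apply_symm_apply]
    exact hu
  · rw [hK, s.apply_symm_apply]
    exact hv i

/-- The divided difference of a form along a reflection. -/
theorem exists_twistAct_sub_eq_smul (b : Module.Basis (Fin l) ℂ V)
    (hα : ∀ H : arrangement W, LinearMap.ker (α H) = (H : Submodule ℂ V)) {s : V ≃ₗ[ℂ] V}
    (hsW : s ∈ W) (hs : IsUnitaryReflection s) {η : PolyForm V l p}
    (hη : η ∈ logNumerators b α p) :
    ∃ H, ∃ θ ∈ logNumerators b α p, twistAct b p s η - η = linForm b (α H) • θ := by
  obtain ⟨H, a, h⟩ := exists_isReflectionWith b hα hsW hs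
  obtain ⟨θ, hθ⟩ := exists_eq_smul_of_forall_dvd (linForm_ne_zero b h.dual_ne_zero) _
    (h.linForm_dvd_twistAct_sub b (hη H))
  refine ⟨H, θ, fun K v hv => ?_, hθ⟩
  by_cases hKH : K = H
  · subst hKH
    exact h.linForm_dvd_of_twistAct_sub_eq b (hη K) hθ hv
  -- For K ≠ H, α_H θ is a difference of two numerators, and α_K is prime to α_H.
  · have hdvd := sub_mem (twistAct_mem_logNumerators hα hsW hs hη) hη K v hv
    rw [hθ, AlternatingMap.smul_apply, smul_eq_mul] at hdvd
    exact (linForm_isRelPrime b (dual_ne_zero b hα K) (dual_ne_zero b hα H)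
      ((ker_dual_injective hα).ne hKH)).dvd_of_dvd_mul_left hdvd

theorem sum_twistAct_mem_antiInvariants [Fintype W] (b : Module.Basis (Fin l) ℂ V)
    (η : PolyForm V l p) : ∑ w : W, twistAct b p w η ∈ antiInvariants b W p := by
  rw [mem_antiInvariants_iff]
  intro w hw
  rw [map_sum]
  refine Fintype.sum_equiv (Equiv.mulLeft (⟨w, hw⟩ : W)) _ _ fun w' => ?_
  exact (twistAct_mul b w w' η).symm

theorem twistAct_mem_span {w : V ≃ₗ[ℂ] V} (hw : w ∈ W) {η : PolyForm V l p}
    (hη : η ∈ Submodule.span (Poly l) (antiInvariants b W p : Set (PolyForm V l p))) :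
    twistAct b p w η ∈ Submodule.span (Poly l) (antiInvariants b W p : Set (PolyForm V l p)) := by
  induction hη using Submodule.span_induction with
  | mem ζ hζ =>
    rw [(mem_antiInvariants_iff b W ζ).mp hζ w hw]
    exact Submodule.subset_span hζ
  | zero => simp
  | add ζ θ _ _ hζ hθ =>
    rw [map_add]
    exact add_mem hζ hθ
  | smul f ζ _ hζ =>
    rw [twistAct_poly_smul]
    exact Submodule.smul_mem _ _ hζ

theorem logNumerators_le_span (hW : IsUnitaryReflectionGroup W)
    (hα : ∀ H : arrangement W, LinearMap.ker (α H) = (H : Submodule ℂ V)) :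
    logNumerators b α p ≤
      Submodule.span (Poly l) (antiInvariants b W p : Set (PolyForm V l p)) := by
  set N := Submodule.span (Poly l) (antiInvariants b W p : Set (PolyForm V l p)) with hN
  have key : ∀ d, ∀ η ∈ logNumerators b α p, (∀ v, η v ∈ degreeLT l d) → η ∈ N := by
    intro d
    induction d with
    | zero =>
      intro η _ hd
      rw [show η = 0 from AlternatingMap.ext fun v => eq_zero_of_mem_degreeLT_zero (hd v)]
      exact N.zero_mem
    | succ d ih =>
      intro η hη hd
      -- The induction on degree handles reflections; stability of N under W extends the congruence
      -- to products and inverses.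
      have hsub : ∀ w ∈ W, twistAct b p w η - η ∈ N := by
        intro w hw
        rw [← hW.2] at hw
        have hgen : ∀ w ∈ Subgroup.closure {s | s ∈ W ∧ IsUnitaryReflection s},
            w ∈ W := fun w hw => hW.2 ▸ hw
        induction hw using Subgroup.closure_induction with
        | mem s hs =>
          obtain ⟨H, θ, hθ, heq⟩ := exists_twistAct_sub_eq_smul b hα hs.1 hs.2 hη
          rw [heq]
          refine N.smul_mem _ (ih θ hθ fun v => ?_)
          refine mem_degreeLT_of_linForm_mul b (dual_ne_zero b hα H) ?_
          have hv := DFunLike.congr_fun heq v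
          rw [AlternatingMap.smul_apply, smul_eq_mul] at hv
          rw [← hv]
          exact sub_mem (twistAct_mem_degreeLT b s hd v) (hd v)
        | one => simp [twistAct_one]
        | mul w w' hw hw' h h' =>
          have : twistAct b p (w * w') η - η =
              twistAct b p w (twistAct b p w' η - η) + (twistAct b p w η - η) := by
            rw [twistAct_mul, map_sub]
            abel
          rw [this]
          exact add_mem (twistAct_mem_span (hgen w hw) h') h
        | inv w hw h =>
          have : twistAct b p w⁻¹ η - η = -twistAct b p w⁻¹ (twistAct b p w η - η) := by
            rw [map_sub, ← twistAct_mul, inv_mul_cancel, twistAct_one]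
            abel
          rw [this]
          exact neg_mem (twistAct_mem_span (W.inv_mem (hgen w hw)) h)
      have := hW.1
      have := Fintype.ofFinite W
      -- The sum of all wη is fixed, hence in N, and differs from |W| η by an element of N.
      have hsum : (Fintype.card W : Poly l) • η ∈ N := by
        have h1 := sub_mem (Submodule.subset_span (sum_twistAct_mem_antiInvariants b η))
          (sum_mem fun (w : W) (_ : w ∈ Finset.univ) => hsub w w.2)
        rwa [Finset.sum_sub_distrib, sub_sub_cancel, Finset.sum_const, Finset.card_univ,
          ← Nat.cast_smul_eq_nsmul (Poly l)] at h1
      have hunit : IsUnit (Fintype.card W : Poly l) := by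
        rw [← map_natCast (MvPolynomial.C : ℂ →+* Poly l)]
        exact (isUnit_iff_ne_zero.mpr (Nat.cast_ne_zero.mpr Fintype.card_ne_zero)).map
          MvPolynomial.C
      exact (Submodule.smul_mem_iff_of_isUnit N hunit).mp hsum
  intro η hη
  obtain ⟨d, hd⟩ := exists_forall_mem_degreeLT b η
  exact key d η hη hd

theorem logNumerators_eq_span (hW : IsUnitaryReflectionGroup W)
    (hα : ∀ H : arrangement W, LinearMap.ker (α H) = (H : Submodule ℂ V)) :
    logNumerators b α p = Submodule.span (Poly l) (antiInvariants b W p : Set (PolyForm V l p)) :=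
  (logNumerators_le_span hW hα).antisymm
    (Submodule.span_le.mpr (antiInvariants_subset_logNumerators hα))

end Generation

/-! ### Injectivity of the multiplication map -/

theorem algebraMap_tmul {R A M : Type*} [CommRing R] [CommRing A] [Algebra R A] [AddCommGroup M]
    [Module R M] (r : R) (m : M) : algebraMap R A r ⊗ₜ[R] m = (1 : A) ⊗ₜ[R] (r • m) := by
  rw [← TensorProduct.smul_tmul, Algebra.smul_def, mul_one]

section Injectivity

variable {V : Type*} [AddCommGroup V] [Module ℂ V] {l : ℕ}

instance antiInvariantsModule (b : Module.Basis (Fin l) ℂ V) (W : Subgroup (V ≃ₗ[ℂ] V)) (p : ℕ) :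
    Module (invariants b W) (antiInvariants b W p) :=
  Submodule.module (antiInvariants b W p)

/-- The action of `w ∈ W` on `S`, as a linear map over the invariants. -/
def invariantAct (b : Module.Basis (Fin l) ℂ V) (W : Subgroup (V ≃ₗ[ℂ] V)) (w : W) :
    Poly l →ₗ[invariants b W] Poly l where
  toFun := polyAct b w
  map_add' := map_add _
  map_smul' := fun r f => by
    change polyAct b w (r * f) = r * polyAct b w f
    rw [map_mul, r.2 w w.2]

/-- The multiplication map `S ⊗_R (Ω^p)^{det⁻¹} → Ω^p`. -/
def polyMulMap (b : Module.Basis (Fin l) ℂ V) (W : Subgroup (V ≃ₗ[ℂ] V)) (p : ℕ) :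
    Poly l ⊗[invariants b W] (antiInvariants b W p) →ₗ[Poly l] PolyForm V l p :=
  LinearMap.liftBaseChange (Poly l) (antiInvariants b W p).subtype

variable {b : Module.Basis (Fin l) ℂ V} {W : Subgroup (V ≃ₗ[ℂ] V)} {p : ℕ}

theorem polyMulMap_tmul (f : Poly l) (m : antiInvariants b W p) :
    polyMulMap b W p (f ⊗ₜ m) = f • (m : PolyForm V l p) := by
  simp [polyMulMap]

/-- The right factor is fixed by the twisted action, so acting on the coefficients alone gives the
twisted action on the product. -/
theorem polyMulMap_rTensor (w : W)
    (t : Poly l ⊗[invariants b W] (antiInvariants b W p)) :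
    polyMulMap b W p ((invariantAct b W w).rTensor _ t) =
      twistAct b p w (polyMulMap b W p t) := by
  induction t with
  | zero => simp
  | add t u ht hu => rw [map_add, map_add, map_add, map_add, ht, hu]
  | tmul f m =>
    rw [LinearMap.rTensor_tmul, polyMulMap_tmul, polyMulMap_tmul, twistAct_poly_smul,
      (mem_antiInvariants_iff b W _).mp m.2 w w.2]
    rfl

theorem range_polyMulMap :
    LinearMap.range (polyMulMap b W p) =
      Submodule.span (Poly l) (antiInvariants b W p : Set (PolyForm V l p)) := by
  refine le_antisymm ?_ (Submodule.span_le.mpr fun η hη => ?_)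
  · rintro _ ⟨t, rfl⟩
    induction t with
    | zero => simp
    | add t u ht hu =>
      rw [map_add]
      exact add_mem ht hu
    | tmul f m =>
      rw [polyMulMap_tmul]
      exact Submodule.smul_mem _ _ (Submodule.subset_span m.2)
  · exact ⟨1 ⊗ₜ ⟨η, hη⟩, by rw [polyMulMap_tmul, one_smul]⟩

/-- The divided difference operator on `S` of a reflection, linear over the invariants. -/
theorem exists_dividedDifference {s : W} {x : Module.Dual ℂ V} {a : V}
    (h : IsReflectionWith (s : V ≃ₗ[ℂ] V) x a) : ∃ δ : Poly l →ₗ[invariants b W] Poly l,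
      ∀ f, linForm b x * δ f = polyAct b s f - f := by
  choose δ hδ using h.linForm_dvd_polyAct_sub b
  have hx := linForm_ne_zero b h.dual_ne_zero
  refine ⟨⟨⟨δ, fun f g => mul_left_cancel₀ hx ?_⟩, fun r f => mul_left_cancel₀ hx ?_⟩,
    fun f => (hδ f).symm⟩
  · rw [mul_add, ← hδ, ← hδ, ← hδ, map_add]
    ring
  · change linForm b x * δ (r * f) = linForm b x * (r * δ f)
    rw [mul_left_comm, ← hδ, ← hδ, map_mul, r.2 s s.2]
    ring

/-- The tensors having a representation with coefficients of degree less than `d`. -/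
def tensorDegreeLT (b : Module.Basis (Fin l) ℂ V) (W : Subgroup (V ≃ₗ[ℂ] V)) (p d : ℕ) :
    AddSubgroup (Poly l ⊗[invariants b W] (antiInvariants b W p)) :=
  AddSubgroup.closure {t | ∃ f ∈ degreeLT l d, ∃ m, t = f ⊗ₜ m}

theorem exists_mem_tensorDegreeLT (t : Poly l ⊗[invariants b W] (antiInvariants b W p)) :
    ∃ d, t ∈ tensorDegreeLT b W p d := by
  have hmono : Monotone (tensorDegreeLT b W p) := fun d e hde =>
    AddSubgroup.closure_mono fun _ ⟨f, hf, h⟩ => ⟨f, degreeLT_mono hde hf, h⟩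
  induction t with
  | zero => exact ⟨0, zero_mem _⟩
  | add t u ht hu =>
    obtain ⟨d, hd⟩ := ht
    obtain ⟨e, he⟩ := hu
    exact ⟨max d e, add_mem (hmono (le_max_left d e) hd) (hmono (le_max_right d e) he)⟩
  | tmul f m => exact ⟨_, AddSubgroup.subset_closure ⟨f, mem_degreeLT_succ f, m, rfl⟩⟩

theorem rTensor_mem_tensorDegreeLT {s : W} {x : Module.Dual ℂ V} (hx : x ≠ 0)
    {δ : Poly l →ₗ[invariants b W] Poly l} (hδ : ∀ f, linForm b x * δ f = polyAct b s f - f)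
    {d : ℕ} {t : Poly l ⊗[invariants b W] (antiInvariants b W p)}
    (ht : t ∈ tensorDegreeLT b W p (d + 1)) :
    δ.rTensor _ t ∈ tensorDegreeLT b W p d := by
  induction ht using AddSubgroup.closure_induction with
  | mem t ht =>
    obtain ⟨f, hf, m, rfl⟩ := ht
    refine AddSubgroup.subset_closure ⟨δ f, ?_, m, LinearMap.rTensor_tmul _ _ _ _⟩
    refine mem_degreeLT_of_linForm_mul b hx ?_
    rw [hδ]
    exact sub_mem (polyAct_mem_degreeLT b s hf) hf
  | zero => simp
  | add t u _ _ ht hu =>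
    rw [map_add]
    exact add_mem ht hu
  | neg t _ ht =>
    rw [map_neg]
    exact neg_mem ht

theorem linForm_smul_rTensor {s : W} {x : Module.Dual ℂ V}
    {δ : Poly l →ₗ[invariants b W] Poly l} (hδ : ∀ f, linForm b x * δ f = polyAct b s f - f)
    (t : Poly l ⊗[invariants b W] (antiInvariants b W p)) :
    linForm b x • δ.rTensor _ t = (invariantAct b W s).rTensor _ t - t := by
  induction t with
  | zero => simp
  | add t u ht hu =>
    rw [map_add, map_add, smul_add, ht, hu]
    abel
  | tmul f m =>
    rw [LinearMap.rTensor_tmul, LinearMap.rTensor_tmul, TensorProduct.smul_tmul', smul_eq_mul, hδ,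
      TensorProduct.sub_tmul]
    rfl

/-- The sum of wf over W is invariant, so it moves across the tensor sign. -/
theorem exists_sum_rTensor_eq [Fintype W]
    (t : Poly l ⊗[invariants b W] (antiInvariants b W p)) :
    ∃ m : antiInvariants b W p, ∑ w : W, (invariantAct b W w).rTensor _ t = 1 ⊗ₜ m := by
  induction t with
  | zero => exact ⟨0, by simp⟩
  | add t u ht hu =>
    obtain ⟨m, hm⟩ := ht
    obtain ⟨n, hn⟩ := hu
    refine ⟨m + n, ?_⟩
    simp only [map_add, Finset.sum_add_distrib, hm, hn, TensorProduct.tmul_add]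
  | tmul f m =>
    let r : invariants b W := ⟨∑ w : W, polyAct b w f, fun w hw => by
      rw [map_sum]
      refine Fintype.sum_equiv (Equiv.mulLeft (⟨w, hw⟩ : W)) _ _ fun w' => ?_
      exact (polyAct_mul b w w' f).symm⟩
    refine ⟨_, Eq.trans ?_ (algebraMap_tmul (A := Poly l) r m)⟩
    simp only [LinearMap.rTensor_tmul, ← TensorProduct.sum_tmul]
    rfl

theorem rTensor_invariantAct_mul (w w' : W)
    (t : Poly l ⊗[invariants b W] (antiInvariants b W p)) :
    (invariantAct b W (w * w')).rTensor _ t =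
      (invariantAct b W w).rTensor _ ((invariantAct b W w').rTensor _ t) := by
  induction t with
  | zero => simp
  | add t u ht hu => rw [map_add, map_add, map_add, ht, hu]
  | tmul f m =>
    rw [LinearMap.rTensor_tmul, LinearMap.rTensor_tmul, LinearMap.rTensor_tmul]
    exact congrArg (· ⊗ₜ m) (polyAct_mul b w w' f)

theorem rTensor_invariantAct_one (t : Poly l ⊗[invariants b W] (antiInvariants b W p)) :
    (invariantAct b W 1).rTensor _ t = t := by
  rw [show invariantAct b W 1 = LinearMap.id from LinearMap.ext fun f => polyAct_one b f,
    LinearMap.rTensor_id, LinearMap.id_apply]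

end Injectivity

/-! ### Descent in the tensor product and division by Q -/

section Main

variable {V : Type*} [NormedAddCommGroup V] [InnerProductSpace ℂ V] {l p : ℕ}
  {b : Module.Basis (Fin l) ℂ V} {W : Subgroup (V ≃ₗ[ℂ] V)}

theorem rTensor_invariantAct_eq_of_forall_reflection (hW : IsUnitaryReflectionGroup W)
    {t : Poly l ⊗[invariants b W] (antiInvariants b W p)}
    (h : ∀ s : W, IsUnitaryReflection (s : V ≃ₗ[ℂ] V) → (invariantAct b W s).rTensor _ t = t)
    (w : W) : (invariantAct b W w).rTensor _ t = t := by
  -- Membership in W is part of the conclusion, because the operator is only defined for elements of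
  -- W.
  have key : ∀ w ∈ Subgroup.closure {s : V ≃ₗ[ℂ] V | s ∈ W ∧ IsUnitaryReflection s},
      ∃ hw : w ∈ W, (invariantAct b W ⟨w, hw⟩).rTensor _ t = t := by
    intro w hw
    induction hw using Subgroup.closure_induction with
    | mem s hs => exact ⟨hs.1, h ⟨s, hs.1⟩ hs.2⟩
    | one => exact ⟨W.one_mem, rTensor_invariantAct_one t⟩
    | mul w w' _ _ hw hw' =>
      obtain ⟨hw, h1⟩ := hw
      obtain ⟨hw', h2⟩ := hw'
      refine ⟨W.mul_mem hw hw', ?_⟩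
      have := rTensor_invariantAct_mul ⟨w, hw⟩ ⟨w', hw'⟩ t
      rwa [h2, h1] at this
    | inv w _ hw =>
      obtain ⟨hw, h1⟩ := hw
      refine ⟨W.inv_mem hw, ?_⟩
      have := rTensor_invariantAct_mul (⟨w, hw⟩ : W)⁻¹ ⟨w, hw⟩ t
      rw [inv_mul_cancel, rTensor_invariantAct_one, h1] at this
      exact this.symm
  exact (key w (hW.2.symm ▸ w.2)).2

theorem eq_zero_of_polyMulMap_eq_zero (hW : IsUnitaryReflectionGroup W)
    {α : arrangement W → Module.Dual ℂ V}
    (hα : ∀ H : arrangement W, LinearMap.ker (α H) = (H : Submodule ℂ V))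
    {t : Poly l ⊗[invariants b W] (antiInvariants b W p)} (ht : polyMulMap b W p t = 0) :
    t = 0 := by
  obtain ⟨d, hd⟩ := exists_mem_tensorDegreeLT t
  induction d generalizing t with
  | zero =>
    have h0 : tensorDegreeLT b W p 0 ≤ ⊥ := by
      refine (AddSubgroup.closure_le _).mpr ?_
      rintro _ ⟨f, hf, m, rfl⟩
      rw [eq_zero_of_mem_degreeLT_zero hf, TensorProduct.zero_tmul]
      exact zero_mem _
    exact AddSubgroup.mem_bot.mp (h0 hd)
  | succ d ih =>
    have hinv := rTensor_invariantAct_eq_of_forall_reflection hW (t := t) fun s hs => by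
      obtain ⟨H, a, h⟩ := exists_isReflectionWith b hα s.2 hs
      obtain ⟨δ, hδ⟩ := exists_dividedDifference (b := b) h
      have hsmul := linForm_smul_rTensor hδ t
      -- Multiplication sends α_H (δ ⊗ 1) t to s·0 - 0 = 0, and Ω^p has no S-torsion.
      have hker : polyMulMap b W p (δ.rTensor _ t) = 0 := by
        have h1 := congrArg (polyMulMap b W p) hsmul
        rw [map_smul, map_sub, polyMulMap_rTensor, ht, map_zero, sub_zero] at h1
        ext1 v
        have h2 := DFunLike.congr_fun h1 v
        exact (mul_eq_zero.mp h2).resolve_left (linForm_ne_zero b h.dual_ne_zero)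
      rw [ih hker (rTensor_mem_tensorDegreeLT h.dual_ne_zero hδ hd), smul_zero] at hsmul
      exact (sub_eq_zero.mp hsmul.symm)
    have := hW.1
    have := Fintype.ofFinite W
    obtain ⟨m, hm⟩ := exists_sum_rTensor_eq t
    simp only [hinv, Finset.sum_const, Finset.card_univ] at hm
    have hm0 : m = 0 := by
      have h1 := congrArg (polyMulMap b W p) hm
      rw [map_nsmul, ht, smul_zero, polyMulMap_tmul, one_smul] at h1
      exact Subtype.ext h1.symm
    rw [hm0, TensorProduct.tmul_zero, ← Nat.cast_smul_eq_nsmul (Poly l)] at hm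
    have hunit : IsUnit (Fintype.card W : Poly l) := by
      rw [← map_natCast (MvPolynomial.C : ℂ →+* Poly l)]
      exact (isUnit_iff_ne_zero.mpr (Nat.cast_ne_zero.mpr Fintype.card_ne_zero)).map
        MvPolynomial.C
    exact hunit.smul_eq_zero.mp hm

/-- Division by `Q`, from the anti-invariant forms onto `(1/Q) (Ω^p)^{det⁻¹}`. -/
def antiInvariantsToDiv (b : Module.Basis (Fin l) ℂ V) (W : Subgroup (V ≃ₗ[ℂ] V)) (Q : Poly l)
    (p : ℕ) : antiInvariants b W p →ₗ[invariants b W] antiInvariantsDiv b W Q p :=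
  ((divForm Q p).restrictScalars (invariants b W)).submoduleMap (antiInvariants b W p)

theorem antiInvariantsToDiv_surjective (Q : Poly l) :
    Function.Surjective (antiInvariantsToDiv b W Q p) :=
  LinearMap.submoduleMap_surjective _ _

theorem mulMap_lTensor (Q : Poly l) (t : Poly l ⊗[invariants b W] (antiInvariants b W p)) :
    mulMap b W Q p ((antiInvariantsToDiv b W Q p).lTensor (Poly l) t) =
      divForm Q p (polyMulMap b W p t) := by
  induction t with
  | zero => simp
  | add t u ht hu => rw [map_add, map_add, map_add, map_add, ht, hu]
  | tmul f m =>
    rw [LinearMap.lTensor_tmul, polyMulMap_tmul, map_smul, mulMap,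
      LinearMap.liftBaseChange_tmul]
    rfl

end Main

end UnitaryReflection

end

theorem theorem1 {V : Type*} [NormedAddCommGroup V] [InnerProductSpace ℂ V] (l : ℕ)
    (b : Module.Basis (Fin l) ℂ V) (W : Subgroup (V ≃ₗ[ℂ] V))
    (hW : UnitaryReflection.IsUnitaryReflectionGroup W)
    (α : UnitaryReflection.arrangement W → Module.Dual ℂ V)
    (hα : ∀ H : UnitaryReflection.arrangement W, LinearMap.ker (α H) = (H : Submodule ℂ V))
    (p : ℕ) (hp : p ≤ l) :
    Function.Injective
        (UnitaryReflection.mulMap b W (UnitaryReflection.definingPoly b W α) p) ∧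
      UnitaryReflection.logForms b (UnitaryReflection.definingPoly b W α) p =
        (LinearMap.range
          (UnitaryReflection.mulMap b W (UnitaryReflection.definingPoly b W α) p) :
          Set (UnitaryReflection.RatForm V l p)) := by
  open UnitaryReflection in
  have := (finite_arrangement hW.1).fintype
  have hα0 := dual_ne_zero b hα
  have hQdef : definingPoly b W α = ∏ H, linForm b (α H) := finprod_eq_prod_of_fintype _
  have hQ : definingPoly b W α ≠ 0 := by
    rw [hQdef]
    exact Finset.prod_ne_zero_iff.mpr fun H _ => linForm_ne_zero b (hα0 H)
  -- Right exactness of the tensor product lifts every tensor to one over the polynomial forms,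
  -- where both claims are already known.
  have hsurj := LinearMap.lTensor_surjective (Poly l)
    (antiInvariantsToDiv_surjective (b := b) (W := W) (p := p) (definingPoly b W α))
  have hmem : ∀ η : PolyForm V l p, divForm (definingPoly b W α) p η ∈
      logForms b (definingPoly b W α) p ↔ ∃ t, polyMulMap b W p t = η := fun η => by
    rw [← LinearMap.mem_range, range_polyMulMap, ← logNumerators_eq_span hW hα, hQdef]
    exact divForm_mem_logForms_iff b α hα0 (ker_dual_injective hα) η
  constructor
  · rw [injective_iff_map_eq_zero]
    intro t ht
    obtain ⟨t, rfl⟩ := hsurj t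
    rw [mulMap_lTensor] at ht
    rw [eq_zero_of_polyMulMap_eq_zero hW hα (divForm_injective hQ (ht.trans (map_zero _).symm)),
      map_zero]
  · ext ω
    constructor
    · intro hω
      obtain ⟨η, rfl⟩ := hω.1
      obtain ⟨t, rfl⟩ := (hmem η).mp hω
      exact ⟨_, mulMap_lTensor _ t⟩
    · rintro ⟨t, rfl⟩
      obtain ⟨t, rfl⟩ := hsurj t
      rw [mulMap_lTensor]
      exact (hmem _).mpr ⟨t, rfl⟩
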